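/- **Lemma (Belavin–Drinfeld triples and the symmetries $Pr=-r$, $rP=-r$).** Let $n\ge 2$, let $E_{pq}$ denote the matrix units of $\mathfrak{gl}(n)=\mathfrak{gl}(n,\mathbb C)$, let $\mathfrak h\subset\mathfrak{gl}(n)$ be the diagonal matrices, and let $\Pi=\{\alpha_1,\dots,\alpha_{n-1}\}$, $\alpha_i=\varepsilon_i-\varepsilon_{i+1}$, be the simple roots of $\mathfrak{sl}(n)$, with $\varepsilon_i(E_{pp})=\delta_{ip}$. For a positive root $\alpha=\varepsilon_p-\varepsilon_q$, $p<q$, put $e_\alpha=E_{pq}$ and $e_{-\alpha}=E_{qp}$. Let $P$ be the permutation operator on $\mathbb C^n\otimes\mathbb C^n$, $x\wedge y=x\otimes y-y\otimes x$, and $r_{21}=PrP$. A Belavin–Drinfeld triple $(\Pi_1,\Pi_2,\tau)$ consists of subsets $\Pi_1,\Pi_2\subset\Pi$ and a bijection $\tau:\Pi_1\to\Pi_2$ such that $\langle\tau(\rho),\tau(\rho')\rangle=\langle\rho,\rho'\rangle$ for all $\rho,\rho'\in\Pi_1$, and $\tau^k(\rho)\ne\rho$ for all $\rho\in\Pi_1$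 and all $k\ge1$ for which $\tau^k(\rho)$ is defined. Extend $\tau^k$ additively to those positive roots all of whose simple components lie in the domain of $\tau^k$, and write $\alpha<\beta$ if $\beta=\tau^k(\alpha)$ for some $k\ge1$. A *non-skew-symmetric classical $r$-matrix with data $(\Pi_1,\Pi_2,\tau)$* is an element $r\in\mathfrak{gl}(n)\otimes\mathfrak{gl}(n)$ such that * $[r_{12},r_{13}]+[r_{12},r_{23}]+[r_{13},r_{23}]=0$; * $r+r_{21}$ is a nonzero linear combination of $P$ and $1\otimes1$; * $r$ has the form $$r=r_0+\sum_{\alpha>0}e_{-\alpha}\otimes e_\alpha+\sum_{\alpha<\beta}e_{-\beta}^{(\alpha)}\wedge e_\alpha ,\qquad r_0\in\mathfrak h\otimes\mathfrak h,$$ where, for $\beta=\tau^k(\alpha)$, $e^{(\alpha)}_{-\beta}$ is the image of $e_{-\alpha}$ under the homomorphism of Lie algebras that sends $e_{-\alpha_i}$ to $e_{-\tau^k(\alpha_i)}$ for the simple components $\alpha_i$ of $\alpha$ (so $e^{(\alpha)}_{-\beta}=\pm e_{-\beta}$, and the sign is $+$ if $\tau^k$ preserves the order of these components), and $$(\alpha\otimes\mathrm{id}+\mathrm{id}\otimes\tau(\alpha))(r_0)=0\quad\text{for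 all }\alpha\in\Pi_1 .$$ The *multiparameters* are the free parameters in $r_0$. Let $(\Pi_1,\Pi_2,\tau)$ be a Belavin–Drinfeld triple for $\mathfrak{sl}(n)$. Then there is a non-skew-symmetric classical $r$-matrix with data $(\Pi_1,\Pi_2,\tau)$ (that is, a choice of the multiparameters) which satisfies $Pr=-r$ if and only if $\tau(\alpha_i)=\alpha_{i+1}$ for all $\alpha_i\in\Pi_1$. There is one which satisfies $rP=-r$ if and only if $\tau(\alpha_i)=\alpha_{i-1}$ for all $\alpha_i\in\Pi_1$. -/

import Mathlib

open scoped Kronecker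

namespace BelavinDrinfeld

/-! ### Root data of `sl(n)`

The basis of `V = ℂⁿ` is indexed by `Fin n`, and the simple positive roots `α_m` by `Fin (n - 1)`
(both counted from `0`). The matrix unit `E_{p q}` sends the `q`-th basis vector to the `p`-th. -/

/-- The index `m`, as an index of a basis vector of `V`. -/
def lo {n : ℕ} (m : Fin (n - 1)) : Fin n := ⟨m, by omega⟩

/-- The index `m + 1`, as an index of a basis vector of `V`. -/
def hi {n : ℕ} (m : Fin (n - 1)) : Fin n := ⟨m + 1, by omega⟩

/-- The simple root `α_m`, given by its values `α_m(E_{p p})` on the diagonal matrix units: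
`α_m = ε_m - ε_{m+1}`. -/
def simpleRoot {n : ℕ} (m : Fin (n - 1)) : Fin n → ℤ :=
  Pi.single (lo m) 1 - Pi.single (hi m) 1

/-- The matrix unit `E_{p q}`. -/
def E {n : ℕ} (p q : Fin n) : Matrix (Fin n) (Fin n) ℂ := Matrix.single p q 1

/-! ### Belavin--Drinfeld triples -/

/-- The partially defined iterate `τ^k` of a map `τ : S → ι` defined on a subset `S` of `ι`;
the value is `none` where `τ^k` is not defined. -/
def partialIterate {ι : Type*} [DecidableEq ι] {S : Finset ι} (τ : S → ι) : ℕ → ι → Option ι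
  | 0, m => some m
  | k + 1, m => if h : m ∈ S then partialIterate τ k (τ ⟨m, h⟩) else none

/-- A Belavin--Drinfeld triple `(Π₁, Π₂, τ)` for `sl(n)`: subsets `Π₁`, `Π₂` of the set of simple
roots and a bijection `τ : Π₁ → Π₂` which preserves the scalar product of roots and is such that
`τ^k(ρ) ≠ ρ` for all `ρ ∈ Π₁` and all `k ≥ 1` for which `τ^k(ρ)` is defined. -/
structure Triple (n : ℕ) where
  Pi₁ : Finset (Fin (n - 1))
  Pi₂ : Finset (Fin (n - 1))
  τ : Pi₁ ≃ Pi₂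
  isometry : ∀ i j : Pi₁,
    simpleRoot (τ i : Fin (n - 1)) ⬝ᵥ simpleRoot (τ j : Fin (n - 1)) =
      simpleRoot (i : Fin (n - 1)) ⬝ᵥ simpleRoot (j : Fin (n - 1))
  nilpotent : ∀ k : ℕ, 1 ≤ k → ∀ i : Pi₁,
    partialIterate (fun m : Pi₁ => (τ m : Fin (n - 1))) k i ≠ some (i : Fin (n - 1))

/-- The partially defined iterate `τ^k` on simple roots. -/
def Triple.iter {n : ℕ} (T : Triple n) : ℕ → Fin (n - 1) → Option (Fin (n - 1)) :=
  partialIterate fun m : T.Pi₁ => (T.τ m : Fin (n - 1))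

/-! ### The `r`-matrix of a triple -/

/-- The iterated commutator `[[… [x_l, x_{l-1}], …, x_2], x_1]` of a list `x_1, …, x_l`. -/
def iteratedBracket {n : ℕ} : List (Matrix (Fin n) (Fin n) ℂ) → Matrix (Fin n) (Fin n) ℂ
  | [] => 0
  | [x] => x
  | x :: y :: l => ⁅iteratedBracket (y :: l), x⁆

/-- The simple negative root vector `e_{-τ^k(α_m)} = E_{m'+1, m'}`, where `τ^k(α_m) = α_{m'}`;
it is `0` if `τ^k(α_m)` is not defined. -/
def Triple.simpleNeg {n : ℕ} (T : Triple n) (k : ℕ) (m : Fin (n - 1)) :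
    Matrix (Fin n) (Fin n) ℂ :=
  match T.iter k m with
  | some m' => E (hi m') (lo m')
  | none => 0

/-- The root vector `e_{-β}` of the root `β = τ^k(α)`, where `α = α_p + ⋯ + α_{q-1}`, `p < q`;
it is `0` if `τ^k(α)` is not defined, that is, if `τ^k` is not defined at one of
`α_p, …, α_{q-1}`.

The root vector of `-α` is `e_{-α} = E_{q p}`, which is the iterated commutator
`[[… [e_{-α_{q-1}}, e_{-α_{q-2}}], …], e_{-α_p}]`, and `e_{-β}` is its image under the homomorphism
of Lie algebras which maps `e_{-α_m}` to `e_{-τ^k(α_m)}`. This is the usual normalization of root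
vectors, compatible with `τ`: `e_{-β}` is the matrix unit of the root `-β`, up to a sign that
appears only when `τ^k` reverses the orientation of the segment `α_p, …, α_{q-1}`. -/
def Triple.negRootVector {n : ℕ} (T : Triple n) (k : ℕ) (p q : Fin n) :
    Matrix (Fin n) (Fin n) ℂ :=
  iteratedBracket
    (((List.finRange (n - 1)).filter fun m => p ≤ lo m ∧ lo m < q).map (T.simpleNeg k))

/-- `x ∧ y = x ⊗ y - y ⊗ x`. -/
def wedge {n : ℕ} (x y : Matrix (Fin n) (Fin n) ℂ) :
    Matrix (Fin n × Fin n) (Fin n × Fin n) ℂ :=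
  x ⊗ₖ y - y ⊗ₖ x

/-- The element `r₀ = ∑ a_{pq} E_{pp} ⊗ E_{qq}` of `𝔥 ⊗ 𝔥`, where `𝔥` is the space of diagonal
matrices. -/
def cartanPart {n : ℕ} (a : Fin n → Fin n → ℂ) : Matrix (Fin n × Fin n) (Fin n × Fin n) ℂ :=
  ∑ p, ∑ q, a p q • (E p p ⊗ₖ E q q)

/-- `r₀ + ∑_{α > 0} e_{-α} ⊗ e_α + ∑_{α < β} e_{-β} ∧ e_α`, where `α < β` means that
`β = τ^k(α)` for some `k ≥ 1`. Positive roots are written as `α = ε_p - ε_q` with `p < q`, and then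
`e_α = E_{p q}`, `e_{-α} = E_{q p}`. By nilpotency, `k` is determined by `α` and `β`, and `τ^k`
is nowhere defined for `k ≥ n - 1`, so the sum over `β` is a sum over `1 ≤ k ≤ n`. -/
def Triple.rMatrix {n : ℕ} (T : Triple n) (a : Fin n → Fin n → ℂ) :
    Matrix (Fin n × Fin n) (Fin n × Fin n) ℂ :=
  cartanPart a
    + (∑ p : Fin n, ∑ q ∈ Finset.univ.filter (fun q => p < q), E q p ⊗ₖ E p q)
    + ∑ p : Fin n, ∑ q ∈ Finset.univ.filter (fun q => p < q), ∑ k ∈ Finset.Icc 1 n,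
        wedge (T.negRootVector k p q) (E p q)

/-- The equation `(α ⊗ id + id ⊗ τ(α))(r₀) = 0` for all `α ∈ Π₁`, where
`r₀ = ∑ a_{pq} E_{pp} ⊗ E_{qq}`; the `s`-th equation is the coefficient of `E_{ss}`. -/
def Triple.Compatible {n : ℕ} (T : Triple n) (a : Fin n → Fin n → ℂ) : Prop :=
  ∀ i : T.Pi₁, ∀ s : Fin n,
    (∑ p, (simpleRoot (i : Fin (n - 1)) p : ℂ) * a p s)
      + (∑ p, (simpleRoot (T.τ i : Fin (n - 1)) p : ℂ) * a s p) = 0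

/-! ### Classical `r`-matrices -/

/-- The permutation operator `P` on `V ⊗ V`, `P(e_i ⊗ e_j) = e_j ⊗ e_i`. -/
def P (n : ℕ) : Matrix (Fin n × Fin n) (Fin n × Fin n) ℂ :=
  Matrix.of fun x y => if x = y.swap then 1 else 0

/-- `r_{21} = P r P`. -/
def flip {n : ℕ} (r : Matrix (Fin n × Fin n) (Fin n × Fin n) ℂ) :
    Matrix (Fin n × Fin n) (Fin n × Fin n) ℂ := P n * r * P n

/-- `r` acting in the factors `1` and `2` of `V ⊗ V ⊗ V`. -/
def leg12 {n : ℕ} (r : Matrix (Fin n × Fin n) (Fin n × Fin n) ℂ) :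
    Matrix (Fin n × Fin n × Fin n) (Fin n × Fin n × Fin n) ℂ :=
  Matrix.of fun x y => if x.2.2 = y.2.2 then r (x.1, x.2.1) (y.1, y.2.1) else 0

/-- `r` acting in the factors `1` and `3` of `V ⊗ V ⊗ V`. -/
def leg13 {n : ℕ} (r : Matrix (Fin n × Fin n) (Fin n × Fin n) ℂ) :
    Matrix (Fin n × Fin n × Fin n) (Fin n × Fin n × Fin n) ℂ :=
  Matrix.of fun x y => if x.2.1 = y.2.1 then r (x.1, x.2.2) (y.1, y.2.2) else 0

/-- `r` acting in the factors `2` and `3` of `V ⊗ V ⊗ V`. -/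
def leg23 {n : ℕ} (r : Matrix (Fin n × Fin n) (Fin n × Fin n) ℂ) :
    Matrix (Fin n × Fin n × Fin n) (Fin n × Fin n × Fin n) ℂ :=
  Matrix.of fun x y => if x.1 = y.1 then r (x.2.1, x.2.2) (y.2.1, y.2.2) else 0

/-- The classical Yang--Baxter equation. -/
def IsClassicalYangBaxter {n : ℕ} (r : Matrix (Fin n × Fin n) (Fin n × Fin n) ℂ) : Prop :=
  ⁅leg12 r, leg13 r⁆ + ⁅leg12 r, leg23 r⁆ + ⁅leg13 r, leg23 r⁆ = 0

/-- `r ∈ gl(n) ⊗ gl(n)` is a non-skew-symmetric classical `r`-matrix with Belavin--Drinfeld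
data `T`, for some choice of the multiparameters: it solves the classical Yang--Baxter equation,
`r₁₂ + r₂₁` is a nonzero linear combination of `P` and the identity, and `r` has the form attached
to `T`, with a Cartan part that is compatible with `T`. -/
structure Triple.IsRMatrix {n : ℕ} (T : Triple n)
    (r : Matrix (Fin n × Fin n) (Fin n × Fin n) ℂ) : Prop where
  yangBaxter : IsClassicalYangBaxter r
  symmetricPart : ∃ b c : ℂ, r + flip r = b • P n + c • 1
  not_skew : r + flip r ≠ 0
  form : ∃ a : Fin n → Fin n → ℂ, T.Compatible a ∧ r = T.rMatrix a

end BelavinDrinfeld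

namespace BelavinDrinfeld

/-! ### The classical Yang--Baxter equation in coordinates -/

/-! Necessity: for p ≠ q the coefficient of E_{qp} ⊗ E_{pq} in r is [p < q], because a wedge term
there would need β = α, which nilpotency forbids (`Triple.negRootVector_apply_self`). Comparing
diagonal entries in Pr = -r therefore forces a_{pq} = -[p < q], and for this r₀ compatibility says
exactly that τ is the shift by +1 (`Triple.compatible_lt_iff`). The case rP = -r is the mirror
image.

Sufficiency: for a shift, the wedge sum has a closed form, and r becomes a matrix with entries [y <
t] - [x < t] on balanced indices and 0 elsewhere (`gervais_eq`, `Triple.rMatrix_of_succ`). With S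
the index set of Π₁, balance is conservation of every weight f on which α_s and α_{s+1} agree for s
∈ S; such f are spanned by affine functions and hinges breaking at s + 1, s ∉ S. Antisymmetry in x,
y is then visible, and the symmetric part is P - 1. In the Yang–Baxter equation each sum over the
contracted index has at most one nonzero term, and convexity of the hinges merges its two balance
conditions into one, common to all six sums; `ind_identity` remains. Transposing and exchanging the
factors gives the case rP = -r. -/

open Classical in
/-- The indicator of a proposition. -/
noncomputable def ind (p : Prop) : ℂ := if p then 1 else 0

@[simp] lemma ind_true {p : Prop} (h : p) : ind p = 1 := if_pos h

@[simp] lemma ind_false {p : Prop} (h : ¬ p) : ind p = 0 := if_neg h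

lemma ind_congr {p q : Prop} (h : p ↔ q) : ind p = ind q := by rw [propext h]

lemma ind_sub_ne_zero {p q : Prop} (h : ind p - ind q ≠ 0) : (p ∧ ¬ q) ∨ (¬ p ∧ q) := by
  by_cases hp : p <;> by_cases hq : q <;> simp_all

/-- The entry of the left-hand side of the classical Yang--Baxter equation. -/
lemma isClassicalYangBaxter_iff {n : ℕ} (r : Matrix (Fin n × Fin n) (Fin n × Fin n) ℂ) :
    IsClassicalYangBaxter r ↔ ∀ a b c i j k : Fin n,
      (∑ m, r (a, b) (m, j) * r (m, c) (i, k)) - (∑ m, r (a, c) (m, k) * r (m, b) (i, j))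
        + ((∑ m, r (a, b) (i, m) * r (m, c) (j, k)) - ∑ m, r (b, c) (m, k) * r (a, m) (i, j))
        + ((∑ m, r (a, c) (i, m) * r (b, m) (j, k)) - ∑ m, r (b, c) (j, m) * r (a, m) (i, k))
        = 0 := by
  unfold IsClassicalYangBaxter
  simp only [Ring.lie_def, ← Matrix.ext_iff, Prod.forall, Matrix.add_apply, Matrix.sub_apply,
    Matrix.mul_apply, Fintype.sum_prod_type, leg12, leg13, leg23, Matrix.of_apply,
    Matrix.zero_apply, ite_mul, mul_ite, zero_mul, mul_zero, Finset.sum_ite_eq,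
    Finset.sum_ite_eq', Finset.mem_univ, if_true, Finset.sum_ite_irrel, Finset.sum_const_zero]

/-- Two pairs of indices with the same sum, such that the sums of the values of each hinge function
`x ↦ max 0 (x - s - 1)`, `s ∉ S`, agree as well. -/
def Balanced (S : ℕ → Prop) (x y z t : ℕ) : Prop :=
  x + y = z + t ∧ ∀ s, ¬ S s → (x - (s + 1)) + (y - (s + 1)) = (z - (s + 1)) + (t - (s + 1))

/-- The analogue of `Balanced` for triples of indices. -/
def Balanced₃ (S : ℕ → Prop) (a b c i j k : ℕ) : Prop :=
  a + b + c = i + j + k ∧ ∀ s, ¬ S s →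
    (a - (s + 1)) + (b - (s + 1)) + (c - (s + 1)) = (i - (s + 1)) + (j - (s + 1)) + (k - (s + 1))

open Classical in
/-- The entries of the `r`-matrix of Cremmer--Gervais type attached to `S`. -/
noncomputable def gervais (S : ℕ → Prop) (x y z t : ℕ) : ℂ :=
  if Balanced S x y z t then ind (y < t) - ind (x < t) else 0

lemma Balanced.swap {S : ℕ → Prop} {x y z t : ℕ} (h : Balanced S x y z t) :
    Balanced S y x z t :=
  ⟨by have := h.1; omega, fun s hs => by have := h.2 s hs; omega⟩

lemma gervais_swap (S : ℕ → Prop) (x y z t : ℕ) : gervais S y x z t = -gervais S x y z t := by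
  unfold gervais
  by_cases h : Balanced S x y z t
  · rw [if_pos h, if_pos h.swap]; ring
  · rw [if_neg h, if_neg fun h' => h h'.swap, neg_zero]

-- Asking for the equivalence only when `v ≠ 0` matters: a balanced triple yields an intermediate
-- index only where the order indicators do not vanish.
open Classical in
lemma sum_ite_of_unique {n : ℕ} (Q : Fin n → Prop) (B : Prop) (v : ℂ)
    (huniq : ∀ m m', Q m → Q m' → m = m') (hv : v ≠ 0 → (B ↔ ∃ m, Q m)) :
    ∑ m, (if Q m then v else 0) = if B then v else 0 := by
  by_cases h0 : v = 0
  · simp [h0]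
  · by_cases hB : B
    · obtain ⟨m, hm⟩ := (hv h0).1 hB
      rw [if_pos hB, Finset.sum_eq_single m, if_pos hm]
      · exact fun m' _ hne => if_neg fun h => hne (huniq _ _ h hm)
      · simp
    · rw [if_neg hB]
      exact Finset.sum_eq_zero fun m _ => if_neg fun h => hB ((hv h0).2 ⟨m, h⟩)

-- The sum rule forces m = a + b - j. If both indicator factors are nonzero, m and j lie between a
-- and b, and i and k between m and c. A convex hinge f then satisfies f a + f b ≥ f m + f j and f m
-- + f c ≥ f i + f k, so equality for the triple splits into equality for both pairs.
open Classical in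
lemma sum_gervais_left {n : ℕ} (S : ℕ → Prop) (a b c i j k : Fin n) :
    ∑ m : Fin n, gervais S a b m j * gervais S m c i k =
      if Balanced₃ S a b c i j k then
        (ind (b < j) - ind (a < j)) * (ind (c < k) - ind (i < c)) else 0 := by
  rw [← sum_ite_of_unique (fun m : Fin n => Balanced S a b m j ∧ Balanced S m c i k)]
  · refine Finset.sum_congr rfl fun m _ => ?_
    unfold gervais
    by_cases h₁ : Balanced S a b m j
    · by_cases h₂ : Balanced S m c i k
      · rw [if_pos h₁, if_pos h₂, if_pos ⟨h₁, h₂⟩]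
        have := h₂.1
        -- Since m + c = i + k, the contracted index can be eliminated from the indicator.
        rw [ind_congr (show (m : ℕ) < k ↔ i < c by omega)]
        rfl
      · simp [h₂]
    · simp [h₁]
  · rintro m m' ⟨h, -⟩ ⟨h', -⟩
    have := h.1; have := h'.1; omega
  · intro hv
    have h₁ := ind_sub_ne_zero (left_ne_zero_of_mul hv)
    have h₂ := ind_sub_ne_zero (right_ne_zero_of_mul hv)
    constructor
    · rintro ⟨h, hs⟩
      refine ⟨⟨a + b - j, by omega⟩, ⟨?_, fun s hS => ?_⟩, ⟨?_, fun s hS => ?_⟩⟩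
      · dsimp only; omega
      · have := hs s hS
        dsimp only; omega
      · dsimp only; omega
      · have := hs s hS
        dsimp only; omega
    · rintro ⟨m, ⟨h, hs⟩, ⟨h', hs'⟩⟩
      refine ⟨by omega, fun s hS => ?_⟩
      have := hs s hS; have := hs' s hS; omega

open Classical in
lemma sum_gervais_right {n : ℕ} (S : ℕ → Prop) (a b c i j k : Fin n) :
    ∑ m : Fin n, gervais S a b i m * gervais S m c j k =
      if Balanced₃ S a b c i j k then
        (ind (i < a) - ind (i < b)) * (ind (c < k) - ind (j < c)) else 0 := by
  rw [← sum_ite_of_unique (fun m : Fin n => Balanced S a b i m ∧ Balanced S m c j k)]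
  · refine Finset.sum_congr rfl fun m _ => ?_
    unfold gervais
    by_cases h₁ : Balanced S a b i m
    · by_cases h₂ : Balanced S m c j k
      · rw [if_pos h₁, if_pos h₂, if_pos ⟨h₁, h₂⟩]
        have := h₁.1; have := h₂.1
        rw [ind_congr (show (m : ℕ) < k ↔ j < c by omega),
          ind_congr (show (b : ℕ) < m ↔ i < a by omega),
          ind_congr (show (a : ℕ) < m ↔ i < b by omega)]
        rfl
      · simp [h₂]
    · simp [h₁]
  · rintro m m' ⟨h, -⟩ ⟨h', -⟩
    have := h.1; have := h'.1; omega
  · intro hv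
    have h₁ := ind_sub_ne_zero (left_ne_zero_of_mul hv)
    have h₂ := ind_sub_ne_zero (right_ne_zero_of_mul hv)
    constructor
    · rintro ⟨h, hs⟩
      refine ⟨⟨a + b - i, by omega⟩, ⟨?_, fun s hS => ?_⟩, ⟨?_, fun s hS => ?_⟩⟩
      · dsimp only; omega
      · have := hs s hS
        dsimp only; omega
      · dsimp only; omega
      · have := hs s hS
        dsimp only; omega
    · rintro ⟨m, ⟨h, hs⟩, ⟨h', hs'⟩⟩
      refine ⟨by omega, fun s hS => ?_⟩
      have := hs s hS; have := hs' s hS; omega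

/-- This is what remains of the Yang–Baxter equation on balanced triples; the sum rule excludes the
order patterns on which it would fail. -/
lemma ind_identity {a b c i j k : ℕ} (h : a + b + c = i + j + k) :
    ind (i < c) * (ind (a < j) + ind (b < k) - ind (b < j) - ind (j < b))
      + ind (a < k) * (ind (b < j) + ind (j < b) - ind (i < b) - ind (j < c))
      + ind (i < b) * ind (j < c) - ind (b < k) * ind (a < j) = 0 := by
  unfold ind
  split_ifs <;> first | (exfalso; omega) | norm_num

lemma gervais_yangBaxter {n : ℕ} (S : ℕ → Prop) (a b c i j k : Fin n) :
    (∑ m : Fin n, gervais S a b m j * gervais S m c i k)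
      - (∑ m : Fin n, gervais S a c m k * gervais S m b i j)
      + ((∑ m : Fin n, gervais S a b i m * gervais S m c j k)
        - ∑ m : Fin n, gervais S b c m k * gervais S a m i j)
      + ((∑ m : Fin n, gervais S a c i m * gervais S b m j k)
        - ∑ m : Fin n, gervais S b c j m * gervais S a m i k) = 0 := by
  -- Antisymmetry moves the contracted index to the first place of the second factor, where the two
  -- summation lemmas apply.
  have e₁ : ∑ m : Fin n, gervais S b c m k * gervais S a m i j =
      -∑ m : Fin n, gervais S b c m k * gervais S m a i j := by
    rw [← Finset.sum_neg_distrib]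
    exact Finset.sum_congr rfl fun m _ => by rw [gervais_swap S m a]; ring
  have e₂ : ∑ m : Fin n, gervais S a c i m * gervais S b m j k =
      -∑ m : Fin n, gervais S a c i m * gervais S m b j k := by
    rw [← Finset.sum_neg_distrib]
    exact Finset.sum_congr rfl fun m _ => by rw [gervais_swap S m b]; ring
  have e₃ : ∑ m : Fin n, gervais S b c j m * gervais S a m i k =
      -∑ m : Fin n, gervais S b c j m * gervais S m a i k := by
    rw [← Finset.sum_neg_distrib]
    exact Finset.sum_congr rfl fun m _ => by rw [gervais_swap S m a]; ring
  rw [e₁, e₂, e₃]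
  simp only [sum_gervais_left, sum_gervais_right]
  -- Balance depends only on the multisets of upper and lower indices, so the six sums share one
  -- condition.
  have perm : ∀ {a b c i j k a' b' c' i' j' k' : ℕ},
      (∀ f : ℕ → ℕ, f a + f b + f c = f a' + f b' + f c') →
      (∀ f : ℕ → ℕ, f i + f j + f k = f i' + f j' + f k') →
      Balanced₃ S a b c i j k → Balanced₃ S a' b' c' i' j' k' := by
    intro a b c i j k a' b' c' i' j' k' h h' hb
    refine ⟨?_, fun s hs => ?_⟩
    · have := h id; have := h' id; have := hb.1; simp only [id] at *; omega
    · have := h fun x => x - (s + 1); have := h' fun x => x - (s + 1); have := hb.2 s hs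
      omega
  by_cases hB : Balanced₃ S a b c i j k
  · rw [if_pos hB, if_pos (perm (fun _ => by ring) (fun _ => by ring) hB), if_pos hB,
      if_pos (perm (fun _ => by ring) (fun _ => by ring) hB),
      if_pos (perm (fun _ => by ring) (fun _ => by ring) hB),
      if_pos (perm (fun _ => by ring) (fun _ => by ring) hB)]
    have := ind_identity hB.1
    linear_combination this
  · rw [if_neg hB, if_neg fun h => hB (perm (fun _ => by ring) (fun _ => by ring) h), if_neg hB,
      if_neg fun h => hB (perm (fun _ => by ring) (fun _ => by ring) h),
      if_neg fun h => hB (perm (fun _ => by ring) (fun _ => by ring) h),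
      if_neg fun h => hB (perm (fun _ => by ring) (fun _ => by ring) h)]
    simp

/-- The `r`-matrix of Cremmer--Gervais type attached to `S`. -/
noncomputable def gervaisMatrix (n : ℕ) (S : ℕ → Prop) :
    Matrix (Fin n × Fin n) (Fin n × Fin n) ℂ :=
  Matrix.of fun x z => gervais S x.1 x.2 z.1 z.2

/-- The image of `gervaisMatrix n S` under transposition and permutation of the tensor factors. -/
noncomputable def gervaisMatrix' (n : ℕ) (S : ℕ → Prop) :
    Matrix (Fin n × Fin n) (Fin n × Fin n) ℂ :=
  Matrix.of fun x z => gervais S z.2 z.1 x.2 x.1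

lemma isClassicalYangBaxter_gervaisMatrix (n : ℕ) (S : ℕ → Prop) :
    IsClassicalYangBaxter (gervaisMatrix n S) :=
  (isClassicalYangBaxter_iff _).2 fun a b c i j k => gervais_yangBaxter S a b c i j k

lemma isClassicalYangBaxter_gervaisMatrix' (n : ℕ) (S : ℕ → Prop) :
    IsClassicalYangBaxter (gervaisMatrix' n S) := by
  refine (isClassicalYangBaxter_iff _).2 fun a b c i j k => ?_
  -- Reversing the three tensor factors and transposing each change the sign of the commutator
  -- expression, so together they preserve the equation.
  have := gervais_yangBaxter S k j i c b a
  simp only [gervaisMatrix', Matrix.of_apply]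
  simp only [mul_comm] at this ⊢
  linear_combination this

/-! ### Multiplication by P and the symmetric part -/

lemma P_mul_apply {n : ℕ} (r : Matrix (Fin n × Fin n) (Fin n × Fin n) ℂ) (x y : Fin n)
    (z : Fin n × Fin n) : (P n * r) (x, y) z = r (y, x) z := by
  rw [Matrix.mul_apply, Finset.sum_eq_single (y, x)]
  · simp [P]
  · rintro ⟨u, v⟩ _ hne
    have : (x, y) ≠ (u, v).swap := fun h => hne (by simp_all)
    simp only [P, Matrix.of_apply, if_neg this, zero_mul]
  · simp

lemma mul_P_apply {n : ℕ} (r : Matrix (Fin n × Fin n) (Fin n × Fin n) ℂ) (x y : Fin n)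
    (z : Fin n × Fin n) : (r * P n) z (x, y) = r z (y, x) := by
  rw [Matrix.mul_apply, Finset.sum_eq_single (y, x)]
  · simp [P]
  · rintro ⟨u, v⟩ _ hne
    have : (u, v) ≠ (x, y).swap := fun h => hne (by simp_all)
    simp only [P, Matrix.of_apply, if_neg this, mul_zero]
  · simp

lemma flip_apply {n : ℕ} (r : Matrix (Fin n × Fin n) (Fin n × Fin n) ℂ) (x y z t : Fin n) :
    flip r (x, y) (z, t) = r (y, x) (t, z) := by
  rw [flip, mul_P_apply, P_mul_apply]

lemma P_mul_gervaisMatrix (n : ℕ) (S : ℕ → Prop) :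
    P n * gervaisMatrix n S = -gervaisMatrix n S := by
  ext ⟨x, y⟩ ⟨z, t⟩
  rw [P_mul_apply]
  exact gervais_swap S x y z t

lemma gervaisMatrix'_mul_P (n : ℕ) (S : ℕ → Prop) :
    gervaisMatrix' n S * P n = -gervaisMatrix' n S := by
  ext ⟨x, y⟩ ⟨z, t⟩
  rw [mul_P_apply]
  exact gervais_swap S t z y x

/-- Since x < z ↔ t < y and y < z ↔ t < x, the indicators add up to [y ≠ t] - [x ≠ t]. -/
lemma gervais_add_flip (S : ℕ → Prop) (x y z t : ℕ) :
    gervais S x y z t + gervais S y x t z = ind (x = t ∧ y = z) - ind (x = z ∧ y = t) := by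
  have key : Balanced S x y z t → Balanced S y x t z := fun h =>
    ⟨by have := h.1; omega, fun s hs => by have := h.2 s hs; omega⟩
  unfold gervais
  by_cases h : Balanced S x y z t
  · rw [if_pos h, if_pos (key h)]
    have := h.1
    unfold ind
    split_ifs <;> first | (exfalso; omega) | norm_num
  · have h' : ¬ Balanced S y x t z := fun h' => h
      ⟨by have := h'.1; omega, fun s hs => by have := h'.2 s hs; omega⟩
    rw [if_neg h, if_neg h', ind_false, ind_false]
    · simp
    · rintro ⟨rfl, rfl⟩; exact h ⟨rfl, fun _ _ => rfl⟩
    · rintro ⟨rfl, rfl⟩; exact h ⟨by omega, fun _ _ => by omega⟩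

lemma P_sub_one_apply {n : ℕ} (x y z t : Fin n) :
    ((1 : ℂ) • P n + (-1 : ℂ) • (1 : Matrix (Fin n × Fin n) (Fin n × Fin n) ℂ)) (x, y) (z, t) =
      ind ((x : ℕ) = t ∧ (y : ℕ) = z) - ind ((x : ℕ) = z ∧ (y : ℕ) = t) := by
  simp only [P, Matrix.one_apply, ind, Fin.ext_iff, Matrix.add_apply, Matrix.smul_apply,
    Matrix.of_apply, Prod.ext_iff, Prod.fst_swap, Prod.snd_swap, smul_eq_mul, one_mul, neg_one_mul,
    sub_eq_add_neg]
  congr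

lemma gervaisMatrix_add_flip (n : ℕ) (S : ℕ → Prop) :
    gervaisMatrix n S + flip (gervaisMatrix n S) = (1 : ℂ) • P n + (-1 : ℂ) • 1 := by
  ext ⟨x, y⟩ ⟨z, t⟩
  rw [P_sub_one_apply, Matrix.add_apply, flip_apply]
  exact gervais_add_flip S x y z t

lemma gervaisMatrix'_add_flip (n : ℕ) (S : ℕ → Prop) :
    gervaisMatrix' n S + flip (gervaisMatrix' n S) = (1 : ℂ) • P n + (-1 : ℂ) • 1 := by
  ext ⟨x, y⟩ ⟨z, t⟩
  rw [P_sub_one_apply, Matrix.add_apply, flip_apply]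
  refine (gervais_add_flip S t z y x).trans ?_
  congr 1 <;> exact ind_congr (by omega)

lemma P_sub_one_ne_zero {n : ℕ} (hn : 2 ≤ n) :
    (1 : ℂ) • P n + (-1 : ℂ) • (1 : Matrix (Fin n × Fin n) (Fin n × Fin n) ℂ) ≠ 0 := by
  intro h
  have := congrFun (congrFun h (⟨0, by omega⟩, ⟨1, by omega⟩)) (⟨1, by omega⟩, ⟨0, by omega⟩)
  rw [P_sub_one_apply] at this
  simp [ind] at this

/-! ### Root vectors -/

lemma partialIterate_add {ι : Type*} [DecidableEq ι] {S : Finset ι} (τ : S → ι) (k l : ℕ)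
    {x y : ι} (h : partialIterate τ k x = some y) :
    partialIterate τ (k + l) x = partialIterate τ l y := by
  induction k generalizing x with
  | zero => cases h; rw [Nat.zero_add]
  | succ k ih =>
    rw [Nat.succ_add]
    simp only [partialIterate] at h ⊢
    split_ifs at h ⊢
    exact ih h

/-- A map which agrees with `τ^k`, `k ≥ 1`, maps no finite nonempty set to itself. -/
lemma Triple.not_mapsTo_iter {n : ℕ} (T : Triple n) {k : ℕ} (hk : 1 ≤ k)
    {I : Set (Fin (n - 1))} {m₀ : Fin (n - 1)} (hm₀ : m₀ ∈ I)
    (h : ∀ m ∈ I, ∃ m' ∈ I, T.iter k m = some m') : False := by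
  classical
  choose! f hf hiter using h
  have hmem : ∀ l, f^[l] m₀ ∈ I := fun l => by
    induction l with
    | zero => exact hm₀
    | succ l ih => rw [Function.iterate_succ_apply']; exact hf _ ih
  have hpow : ∀ l, ∀ m ∈ I, T.iter (l * k) m = some (f^[l] m) := fun l => by
    induction l with
    | zero => intro m _; rw [Nat.zero_mul]; rfl
    | succ l ih =>
      intro m hm
      rw [Nat.succ_mul, Nat.add_comm]
      exact (partialIterate_add _ _ _ (hiter m hm)).trans (ih _ (hf m hm))
  -- By pigeonhole the orbit of `m₀` meets itself, which gives a periodic point of τ.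
  obtain ⟨i, j, hne, hij⟩ := Finite.exists_ne_map_eq_of_infinite fun l => f^[l] m₀
  wlog hlt : i < j generalizing i j
  · exact this j i hne.symm hij.symm (by omega)
  have hper : T.iter ((j - i) * k) (f^[i] m₀) = some (f^[i] m₀) := by
    rw [hpow _ _ (hmem i), ← Function.iterate_add_apply, Nat.sub_add_cancel hlt.le]
    exact congrArg some hij.symm
  have hpos : 1 ≤ (j - i) * k := Nat.mul_pos (by omega) hk
  have hPi : f^[i] m₀ ∈ T.Pi₁ := by
    by_contra hn
    obtain ⟨l, hl⟩ : ∃ l, (j - i) * k = l + 1 := ⟨(j - i) * k - 1, by omega⟩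
    rw [hl] at hper
    simp [Triple.iter, partialIterate, hn] at hper
  exact T.nilpotent _ hpos ⟨_, hPi⟩ hper

lemma iteratedBracket_eq_zero {n : ℕ} {l : List (Matrix (Fin n) (Fin n) ℂ)} (h : 0 ∈ l) :
    iteratedBracket l = 0 := by
  induction l with
  | nil => rfl
  | cons x l ih =>
    cases l with
    | nil => simpa [iteratedBracket, eq_comm] using h
    | cons y l =>
      rcases List.mem_cons.1 h with h | h
      · simp [iteratedBracket, ← h, Ring.lie_def]
      · simp [iteratedBracket, ih h, Ring.lie_def]

/-- The weight of a nonzero entry of an iterated commutator of matrices that are homogeneous with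
respect to the grading `φ`. -/
lemma iteratedBracket_weight {n : ℕ} {ι : Type*} (φ : Fin n → ℤ) (d : ι → ℤ)
    (X : ι → Matrix (Fin n) (Fin n) ℂ) (l : List ι)
    (hX : ∀ i ∈ l, ∀ x y, X i x y ≠ 0 → φ x - φ y = d i) (x y : Fin n)
    (h : iteratedBracket (l.map X) x y ≠ 0) : φ x - φ y = (l.map d).sum := by
  induction l generalizing x y with
  | nil => exact absurd rfl h
  | cons i l ih =>
    cases l with
    | nil => simpa using hX i (by simp) x y h
    | cons j l =>
      have ih' := ih fun i' hi' => hX i' (List.mem_cons_of_mem _ hi')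
      have hi := hX i (by simp)
      rw [List.map_cons, List.map_cons, iteratedBracket, Ring.lie_def, Matrix.sub_apply] at h
      rw [List.map_cons, List.sum_cons]
      have : (iteratedBracket ((j :: l).map X) * X i) x y ≠ 0 ∨
          (X i * iteratedBracket ((j :: l).map X)) x y ≠ 0 := by
        by_contra! hc
        exact h (by rw [← List.map_cons, hc.1, hc.2, sub_zero])
      rcases this with h | h <;> rw [Matrix.mul_apply] at h <;>
        obtain ⟨z, -, hz⟩ := Finset.exists_ne_zero_of_sum_ne_zero h
      · have := ih' x z (left_ne_zero_of_mul hz)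
        have := hi z y (right_ne_zero_of_mul hz)
        omega
      · have := hi x z (left_ne_zero_of_mul hz)
        have := ih' z y (right_ne_zero_of_mul hz)
        omega

/-- `τ^k`, `k ≥ 1`, fixes no positive root. -/
lemma Triple.negRootVector_apply_self {n : ℕ} (T : Triple n) {k : ℕ} (hk : 1 ≤ k) {p q : Fin n}
    (hpq : p < q) : T.negRootVector k p q q p = 0 := by
  by_contra h
  set l := (List.finRange (n - 1)).filter fun m => p ≤ lo m ∧ lo m < q with hl
  have hmem : ∀ m, m ∈ l ↔ p ≤ lo m ∧ lo m < q := fun m => by simp [hl]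
  have hne : ∀ m ∈ l, ∃ m', T.iter k m = some m' := by
    intro m hm
    by_contra! hnone
    refine h ?_
    have : T.simpleNeg k m = 0 := by
      unfold Triple.simpleNeg
      rw [Option.eq_none_iff_forall_ne_some.2 hnone]
    rw [Triple.negRootVector, iteratedBracket_eq_zero (this ▸ List.mem_map_of_mem hm)]
    rfl
  choose! g hg using hne
  refine T.not_mapsTo_iter hk (I := {m | m ∈ l}) (m₀ := ⟨p, by omega⟩)
    ((hmem _).2 ⟨le_refl _, hpq⟩) fun m hm => ⟨g m, ?_, hg m hm⟩
  -- Up to sign and a constant, this grading is the fundamental coweight of α_{g m}: it counts the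
  -- occurrences of that root in τ^k(α). The count is at least 1, so p ≤ g m < q, and τ^k maps the
  -- segment of α to itself.
  have hw := iteratedBracket_weight (fun x => if (g m : ℕ) < x then 1 else 0)
    (fun i => if g i = g m then 1 else 0) (T.simpleNeg k) l (by
      intro i hil x y hxy
      rw [Triple.simpleNeg, hg i hil] at hxy
      simp only [E, Matrix.single_apply, ne_eq, ite_eq_right_iff, one_ne_zero, imp_false,
        not_not] at hxy
      obtain ⟨rfl, rfl⟩ := hxy
      simp only [hi, lo, Fin.ext_iff]
      split_ifs <;> omega) q p h
  have hpos : 1 ≤ (l.map fun i => if g i = g m then (1 : ℤ) else 0).sum := by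
    refine List.single_le_sum ?_ _ ?_
    · simp only [List.mem_map]
      rintro _ ⟨i, -, rfl⟩
      split_ifs <;> norm_num
    · exact List.mem_map.2 ⟨m, hm, if_pos rfl⟩
  refine (hmem _).2 ?_
  simp only [lo, Fin.le_def, Fin.lt_def]
  split_ifs at hw <;> omega

/-- Splitting off the lowest simple component of the segment; this drives the induction on its
length. -/
lemma negRootVector_lo {n : ℕ} (T : Triple n) (k : ℕ) {m : Fin (n - 1)} {q : Fin n}
    (h : lo m < q) : T.negRootVector k (lo m) q =
      if hi m = q then T.simpleNeg k m else ⁅T.negRootVector k (hi m) q, T.simpleNeg k m⁆ := by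
  have hcons : ((List.finRange (n - 1)).filter fun m' => lo m ≤ lo m' ∧ lo m' < q) =
      m :: (List.finRange (n - 1)).filter fun m' => hi m ≤ lo m' ∧ lo m' < q := by
    refine List.SortedLT.eq_of_mem_iff ?_ ?_ fun m' => ?_
    · exact ((List.pairwise_lt_finRange _).filter _).sortedLT
    · refine (List.pairwise_cons.2 ⟨fun m' hm' => ?_,
        (List.pairwise_lt_finRange _).filter _⟩).sortedLT
      simp only [hi, lo, Fin.le_def, List.mem_filter, decide_eq_true_eq] at hm'
      rw [Fin.lt_def]; omega
    · simp only [List.mem_filter, List.mem_finRange, true_and, decide_eq_true_eq, List.mem_cons]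
      simp only [hi, lo, Fin.le_def, Fin.lt_def, Fin.ext_iff] at h ⊢
      omega
  rw [Triple.negRootVector, hcons]
  split_ifs with hq
  · have : ((List.finRange (n - 1)).filter fun m' => hi m ≤ lo m' ∧ lo m' < q) = [] := by
      subst hq
      simp
    rw [this]
    rfl
  · have hm : (⟨m + 1, by simp only [hi, lo, Fin.lt_def, Fin.ext_iff] at h hq; omega⟩ : Fin (n - 1)) ∈
        (List.finRange (n - 1)).filter fun m' => hi m ≤ lo m' ∧ lo m' < q := by
      simp only [List.mem_filter, List.mem_finRange, true_and, decide_eq_true_eq]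
      simp only [hi, lo, Fin.lt_def, Fin.ext_iff, Fin.le_def] at h hq ⊢
      omega
    rw [Triple.negRootVector]
    cases hc : (List.finRange (n - 1)).filter fun m' => hi m ≤ lo m' ∧ lo m' < q with
    | nil => rw [hc] at hm; simp at hm
    | cons y l => rfl

/-- The root vector of `-τ^k(α)` if `τ^k` shifts the simple components of `α` by `κ`. -/
lemma Triple.negRootVector_shift {n : ℕ} (T : Triple n) (k : ℕ) (κ : ℤ) (q : Fin n) (d : ℕ)
    (p : Fin n) (hd : (p : ℕ) + d + 1 = q)
    (h : ∀ m, p ≤ lo m → lo m < q → ∃ m', T.iter k m = some m' ∧ (m' : ℤ) = m + κ) :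
    ∃ p' q' : Fin n, T.negRootVector k p q = E q' p' ∧ (q' : ℤ) = q + κ ∧ (p' : ℤ) = p + κ := by
  induction d generalizing p with
  | zero =>
    obtain ⟨m, rfl⟩ : ∃ m : Fin (n - 1), p = lo m := ⟨⟨p, by omega⟩, rfl⟩
    have hlt : lo m < q := by rw [Fin.lt_def]; omega
    obtain ⟨m', hm', hκ⟩ := h m le_rfl hlt
    rw [negRootVector_lo _ _ hlt, if_pos (by ext; simp only [hi, lo] at hd ⊢; omega),
      Triple.simpleNeg, hm']
    refine ⟨lo m', hi m', rfl, ?_, ?_⟩ <;> simp only [hi, lo] at hd ⊢ <;> push_cast <;> omega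
  | succ d ih =>
    obtain ⟨m, rfl⟩ : ∃ m : Fin (n - 1), p = lo m := ⟨⟨p, by omega⟩, rfl⟩
    have hlt : lo m < q := by rw [Fin.lt_def]; omega
    obtain ⟨m', hm', hκ⟩ := h m le_rfl hlt
    obtain ⟨p', q', hE, hq', hp'⟩ := ih (hi m) (by simp only [hi, lo] at hd ⊢; omega)
      fun m₁ h₁ h₂ => h m₁ (by simp only [hi, lo, Fin.le_def] at h₁ ⊢; omega) h₂
    -- Of the two products in the commutator, this kills the one with a minus sign, so a shift
    -- produces no sign.
    have hne : q' ≠ lo m' := by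
      rintro rfl
      simp only [hi, lo] at hd hq' hp'; omega
    have hpe : p' = hi m' := by
      ext
      simp only [hi] at hp' ⊢; push_cast at hp'; omega
    rw [negRootVector_lo _ _ hlt, if_neg (by
      intro hc; rw [← hc] at hd; simp only [hi, lo] at hd; omega), hE, Triple.simpleNeg, hm']
    refine ⟨lo m', q', ?_, hq', ?_⟩
    · rw [hpe, Ring.lie_def]
      simp [E, Matrix.single_mul_single_of_ne, hne.symm]
    · simp only [lo]; omega

lemma Triple.negRootVector_eq_zero {n : ℕ} (T : Triple n) {k : ℕ} {p q : Fin n}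
    {m : Fin (n - 1)} (hp : p ≤ lo m) (hq : lo m < q) (h : T.iter k m = none) :
    T.negRootVector k p q = 0 := by
  have h0 : T.simpleNeg k m = 0 := by rw [Triple.simpleNeg, h]
  exact iteratedBracket_eq_zero (List.mem_map.2 ⟨m, by simp [hp, hq], h0⟩)

/-! ### The entries of the `r`-matrix -/

/-- The contribution of the root `α = ε_p - ε_q` to an entry of `∑_{α < β} e_{-β} ⊗ e_α`. -/
noncomputable def Triple.wedgeEntry {n : ℕ} (T : Triple n) (p q x z : Fin n) : ℂ :=
  if p < q then ∑ k ∈ Finset.Icc 1 n, T.negRootVector k p q x z else 0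

lemma cartanPart_apply {n : ℕ} (a : Fin n → Fin n → ℂ) (x y z t : Fin n) :
    cartanPart a (x, y) (z, t) = if x = z ∧ y = t then a x y else 0 := by
  simp only [cartanPart, Matrix.sum_apply, Matrix.smul_apply, Matrix.kroneckerMap_apply, E,
    Matrix.single_apply, smul_eq_mul]
  rw [Finset.sum_eq_single x, Finset.sum_eq_single y]
  · by_cases h₁ : x = z <;> by_cases h₂ : y = t <;> simp [h₁, h₂]
  · intro q _ hq; simp [hq]
  · simp
  · intro p _ hp; simp [hp]
  · simp

lemma sum_pos_kronecker_E {n : ℕ} (N : Fin n → Fin n → Matrix (Fin n) (Fin n) ℂ)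
    (x y z t : Fin n) :
    ∑ p : Fin n, ∑ q ∈ Finset.univ.filter (fun q => p < q), N p q x z * E p q y t =
      if y < t then N y t x z else 0 := by
  simp only [Finset.sum_filter, E, Matrix.single_apply]
  rw [Finset.sum_eq_single y, Finset.sum_eq_single t]
  · simp
  · intro q _ hq; simp [hq]
  · simp
  · intro p _ hp; simp [hp]
  · simp

lemma Triple.rMatrix_apply {n : ℕ} (T : Triple n) (a : Fin n → Fin n → ℂ) (x y z t : Fin n) :
    T.rMatrix a (x, y) (z, t) = (if x = z ∧ y = t then a x y else 0)
      + (if y < t then E t y x z else 0) + (T.wedgeEntry y t x z - T.wedgeEntry x z y t) := by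
  simp only [Triple.rMatrix, Matrix.add_apply, cartanPart_apply, Matrix.sum_apply, wedge,
    Matrix.sub_apply, Matrix.kroneckerMap_apply, Finset.sum_sub_distrib]
  rw [sum_pos_kronecker_E fun p q => E q p]
  have h₁ := sum_pos_kronecker_E (fun p q => ∑ k ∈ Finset.Icc 1 n, T.negRootVector k p q) x y z t
  have h₂ := sum_pos_kronecker_E (fun p q => ∑ k ∈ Finset.Icc 1 n, T.negRootVector k p q) y x t z
  simp only [Matrix.sum_apply, Finset.sum_mul] at h₁ h₂
  simp only [mul_comm (E _ _ x z)]
  rw [h₁, h₂]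
  rfl

lemma Triple.rMatrix_apply_self {n : ℕ} (T : Triple n) (a : Fin n → Fin n → ℂ) (p q : Fin n) :
    T.rMatrix a (p, q) (p, q) = a p q := by
  simp [T.rMatrix_apply, Triple.wedgeEntry]

lemma Triple.wedgeEntry_self {n : ℕ} (T : Triple n) (p q : Fin n) :
    T.wedgeEntry p q q p = 0 := by
  unfold Triple.wedgeEntry
  split_ifs with h
  · exact Finset.sum_eq_zero fun k hk => T.negRootVector_apply_self (Finset.mem_Icc.1 hk).1 h
  · rfl

/-- Only the standard part ∑ e_{-α} ⊗ e_α contributes, so this entry does not depend on the triple.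
-/
lemma Triple.rMatrix_apply_swap {n : ℕ} (T : Triple n) (a : Fin n → Fin n → ℂ) {p q : Fin n}
    (hpq : p ≠ q) : T.rMatrix a (q, p) (p, q) = ind (p < q) := by
  simp [T.rMatrix_apply, T.wedgeEntry_self, E, ind, hpq.symm]

lemma Triple.rMatrix_eq_of_P_mul {n : ℕ} (T : Triple n) {a : Fin n → Fin n → ℂ}
    (h : P n * T.rMatrix a = -T.rMatrix a) (p q : Fin n) : a p q = -ind (p < q) := by
  have := congrFun (congrFun h (p, q)) (p, q)
  rw [P_mul_apply, Matrix.neg_apply, T.rMatrix_apply_self] at this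
  rcases eq_or_ne p q with rfl | hpq
  · rw [T.rMatrix_apply_self] at this
    rw [ind_false (lt_irrefl p)]
    linear_combination this / 2
  · rw [T.rMatrix_apply_swap a hpq] at this
    rw [this, neg_neg]

lemma Triple.rMatrix_eq_of_mul_P {n : ℕ} (T : Triple n) {a : Fin n → Fin n → ℂ}
    (h : T.rMatrix a * P n = -T.rMatrix a) (p q : Fin n) : a p q = -ind (q < p) := by
  have := congrFun (congrFun h (p, q)) (p, q)
  rw [mul_P_apply, Matrix.neg_apply, T.rMatrix_apply_self] at this
  rcases eq_or_ne p q with rfl | hpq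
  · rw [T.rMatrix_apply_self] at this
    rw [ind_false (lt_irrefl p)]
    linear_combination this / 2
  · rw [T.rMatrix_apply_swap a hpq.symm] at this
    rw [this, neg_neg]

lemma sum_simpleRoot_mul {n : ℕ} (m : Fin (n - 1)) (f : Fin n → ℂ) :
    ∑ p, (simpleRoot m p : ℂ) * f p = f (lo m) - f (hi m) := by
  simp [simpleRoot, Pi.single_apply, sub_mul, Finset.sum_sub_distrib]

/-- The compatibility condition for the Cartan part `-∑_{p < q} E_{pp} ⊗ E_{qq}`. -/
lemma Triple.compatible_lt_iff {n : ℕ} (T : Triple n) :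
    T.Compatible (fun p q => -ind (p < q)) ↔
      ∀ i : T.Pi₁, ((T.τ i : Fin (n - 1)) : ℕ) = ((i : Fin (n - 1)) : ℕ) + 1 := by
  -- Differences of adjacent step functions are point masses, so the equations for all `s` say that
  -- two basis indices coincide.
  have key : ∀ (i j : Fin (n - 1)) (s : Fin n),
      -ind (lo i < s) - -ind (hi i < s) + (-ind (s < lo j) - -ind (s < hi j)) =
        ind (s = lo j) - ind (s = hi i) := by
    intro i j s
    simp only [ind, lo, hi, Fin.lt_def, Fin.ext_iff]
    split_ifs <;> first | (exfalso; omega) | norm_num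
  simp only [Triple.Compatible, sum_simpleRoot_mul, key]
  refine forall_congr' fun i => ⟨fun h => ?_, fun h s => ?_⟩
  · by_contra hne
    have hne' : hi (i : Fin (n - 1)) ≠ lo (T.τ i : Fin (n - 1)) := fun hc =>
      hne (Fin.ext_iff.1 hc).symm
    have := h (hi i)
    rw [ind_true rfl, ind_false hne'] at this
    norm_num at this
  · have : lo (T.τ i : Fin (n - 1)) = hi i := Fin.ext h
    rw [this, sub_self]

/-- The compatibility condition for the Cartan part `-∑_{p < q} E_{qq} ⊗ E_{pp}`. -/
lemma Triple.compatible_gt_iff {n : ℕ} (T : Triple n) :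
    T.Compatible (fun p q => -ind (q < p)) ↔
      ∀ i : T.Pi₁, ((T.τ i : Fin (n - 1)) : ℕ) + 1 = ((i : Fin (n - 1)) : ℕ) := by
  have key : ∀ (i j : Fin (n - 1)) (s : Fin n),
      -ind (s < lo i) - -ind (s < hi i) + (-ind (lo j < s) - -ind (hi j < s)) =
        ind (s = lo i) - ind (s = hi j) := by
    intro i j s
    simp only [ind, lo, hi, Fin.lt_def, Fin.ext_iff]
    split_ifs <;> first | (exfalso; omega) | norm_num
  simp only [Triple.Compatible, sum_simpleRoot_mul, key]
  refine forall_congr' fun i => ⟨fun h => ?_, fun h s => ?_⟩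
  · by_contra hne
    have hne' : hi (T.τ i : Fin (n - 1)) ≠ lo (i : Fin (n - 1)) := fun hc =>
      hne (Fin.ext_iff.1 hc)
    have := h (hi (T.τ i))
    rw [ind_true rfl, ind_false hne'] at this
    norm_num at this
  · have : hi (T.τ i : Fin (n - 1)) = lo i := Fin.ext h
    rw [this, sub_self]

/-! ### Triples with `τ` a shift -/

/-- If `τ` shifts the indices of the simple roots by `ε`, then `τ^k` shifts them by `k ε`, and it is
defined at `m` if and only if `m, m + ε, …, m + (k - 1) ε` belong to `Π₁`. -/
lemma Triple.iter_shift {n : ℕ} (T : Triple n) {ε : ℤ}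
    (hτ : ∀ i : T.Pi₁, ((T.τ i : Fin (n - 1)) : ℤ) = ((i : Fin (n - 1)) : ℤ) + ε) (k : ℕ)
    (m : Fin (n - 1)) :
    ((∀ l < k, ∃ i ∈ T.Pi₁, ((i : ℕ) : ℤ) = m + l * ε) →
        ∃ m', T.iter k m = some m' ∧ (m' : ℤ) = m + k * ε) ∧
      ((∃ l < k, ¬ ∃ i ∈ T.Pi₁, ((i : ℕ) : ℤ) = m + l * ε) → T.iter k m = none) := by
  induction k generalizing m with
  | zero => exact ⟨fun _ => ⟨m, rfl, by simp⟩, by rintro ⟨l, hl, -⟩; omega⟩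
  | succ k ih =>
    by_cases hm : m ∈ T.Pi₁
    · have hstep : T.iter (k + 1) m = T.iter k (T.τ ⟨m, hm⟩) := by
        simp only [Triple.iter, partialIterate, dif_pos hm]
      have hτm := hτ ⟨m, hm⟩
      simp only at hτm
      rw [hstep]
      constructor
      · intro h
        obtain ⟨m', h₁, h₂⟩ := (ih (T.τ ⟨m, hm⟩)).1 fun l hl => by
          obtain ⟨i, hi, he⟩ := h (l + 1) (by omega)
          exact ⟨i, hi, by rw [he, hτm]; push_cast; ring⟩
        exact ⟨m', h₁, by rw [h₂, hτm]; push_cast; ring⟩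
      · rintro ⟨l, hl, h⟩
        cases l with
        | zero => exact absurd ⟨m, hm, by simp⟩ h
        | succ l =>
          refine (ih (T.τ ⟨m, hm⟩)).2 ⟨l, by omega, fun ⟨i, hi, he⟩ => h ⟨i, hi, ?_⟩⟩
          rw [he, hτm]; push_cast; ring
    · have hnone : T.iter (k + 1) m = none := by
        simp only [Triple.iter, partialIterate, dif_neg hm]
      refine ⟨fun h => ?_, fun _ => hnone⟩
      obtain ⟨i, hi, he⟩ := h 0 (by omega)
      have : i = m := by ext; simpa using he
      exact absurd (this ▸ hi) hm

/-- The indices are cast to ℤ so that both directions of the shift are treated together; τ^k is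
defined on α exactly when the whole grid m + lε lies in Π₁. -/
lemma Triple.negRootVector_apply_of_shift {n : ℕ} (T : Triple n) {ε : ℤ}
    (hτ : ∀ i : T.Pi₁, ((T.τ i : Fin (n - 1)) : ℤ) = ((i : Fin (n - 1)) : ℤ) + ε) (k : ℕ)
    {y t : Fin n} (hyt : y < t) (x z : Fin n) :
    T.negRootVector k y t x z = ind ((x : ℤ) = t + k * ε ∧ (z : ℤ) = y + k * ε ∧
      ∀ m l : ℕ, y ≤ m → m < t → l < k → ∃ i ∈ T.Pi₁, ((i : ℕ) : ℤ) = m + l * ε) := by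
  by_cases hD : ∀ m l : ℕ, y ≤ m → m < t → l < k → ∃ i ∈ T.Pi₁, ((i : ℕ) : ℤ) = m + l * ε
  · obtain ⟨p', q', hE, hq, hp⟩ := T.negRootVector_shift k (k * ε) t (t - y - 1) y (by omega)
      fun m h₁ h₂ => (T.iter_shift hτ k m).1 fun l hl => hD m l h₁ h₂ hl
    rw [hE, ← hq, ← hp]
    simp only [E, Matrix.single_apply, ind, Fin.ext_iff, Nat.cast_inj]
    simp only [eq_comm]
    congr 1
    exact propext ⟨fun h => ⟨congrArg _ h.1, congrArg _ h.2, hD⟩,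
      fun h => ⟨Nat.cast_injective h.1, Nat.cast_injective h.2.1⟩⟩
  · rw [ind_false fun h => hD h.2.2]
    push Not at hD
    obtain ⟨m, l, h₁, h₂, hl, hne⟩ := hD
    have hm : m < n - 1 := by omega
    have := T.negRootVector_eq_zero (m := ⟨m, hm⟩) (k := k) (p := y) (q := t) h₁ h₂
      ((T.iter_shift hτ k _).2 ⟨l, hl, by push Not; exact hne⟩)
    rw [this]; rfl

lemma sum_ind_of_unique (s : Finset ℕ) (Q : ℕ → Prop) (h : ∀ k k', Q k → Q k' → k = k') :
    ∑ k ∈ s, ind (Q k) = ind (∃ k ∈ s, Q k) := by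
  by_cases hex : ∃ k ∈ s, Q k
  · obtain ⟨k, hk, hQ⟩ := hex
    rw [ind_true ⟨k, hk, hQ⟩, Finset.sum_eq_single_of_mem k hk, ind_true hQ]
    exact fun k' _ hne => ind_false fun hQ' => hne (h _ _ hQ' hQ)
  · rw [ind_false hex]
    exact Finset.sum_eq_zero fun k hk => ind_false fun hQ => hex ⟨k, hk, hQ⟩

lemma Triple.wedgeEntry_of_shift {n : ℕ} (T : Triple n) {ε : ℤ} (hε : ε ≠ 0)
    (hτ : ∀ i : T.Pi₁, ((T.τ i : Fin (n - 1)) : ℤ) = ((i : Fin (n - 1)) : ℤ) + ε)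
    (y t x z : Fin n) :
    T.wedgeEntry y t x z = ind (y < t ∧ ∃ k ∈ Finset.Icc 1 n,
      (x : ℤ) = t + k * ε ∧ (z : ℤ) = y + k * ε ∧
      ∀ m l : ℕ, y ≤ m → m < t → l < k → ∃ i ∈ T.Pi₁, ((i : ℕ) : ℤ) = m + l * ε) := by
  unfold Triple.wedgeEntry
  split_ifs with hyt
  · simp only [T.negRootVector_apply_of_shift hτ _ hyt, hyt, true_and]
    refine sum_ind_of_unique _ _ fun k k' h h' => ?_
    have : (k : ℤ) * ε = k' * ε := by have := h.1; have := h'.1; omega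
    exact_mod_cast mul_right_cancel₀ hε this
  · rw [ind_false fun h => hyt h.1]

/-- The root vector `E_{x z} ⊗ E_{y t}` occurs in the sum over `α < β` for the set `S`. -/
def Linked (S : ℕ → Prop) (x y z t : ℕ) : Prop :=
  y < t ∧ y < z ∧ x + y = z + t ∧ ∀ s, y ≤ s → s + 2 ≤ x → S s

lemma Triple.wedgeEntry_of_succ {n : ℕ} (T : Triple n)
    (hτ : ∀ i : T.Pi₁, ((T.τ i : Fin (n - 1)) : ℕ) = ((i : Fin (n - 1)) : ℕ) + 1)
    (y t x z : Fin n) :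
    T.wedgeEntry y t x z = ind (Linked (fun s => ∃ i ∈ T.Pi₁, (i : ℕ) = s) x y z t) := by
  rw [T.wedgeEntry_of_shift one_ne_zero fun i => by rw [hτ i]; push_cast; ring]
  refine ind_congr (and_congr_right fun hyt => ⟨?_, ?_⟩)
  · rintro ⟨k, hk, h₁, h₂, h⟩
    rw [Finset.mem_Icc] at hk
    refine ⟨by omega, by omega, fun s hs hs' => ?_⟩
    -- The grid m + l with y ≤ m < t and l < k sweeps out the interval from y to t + k - 2 = x - 2.
    obtain ⟨i, hi, he⟩ := h (min s (t - 1)) (s - min s (t - 1)) (by omega) (by omega) (by omega)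
    exact ⟨i, hi, by omega⟩
  · rintro ⟨h₁, h₂, h⟩
    refine ⟨z - y, Finset.mem_Icc.2 (by omega), by omega, by omega, fun m l hm hm' hl => ?_⟩
    obtain ⟨i, hi, he⟩ := h (m + l) (by omega) (by omega)
    exact ⟨i, hi, by omega⟩

/-- The set consists of the `s` with α_{s+1} ∈ Π₁, that is, of the indices of Π₂: it is the data of
the inverse shift. -/
lemma Triple.wedgeEntry_of_pred {n : ℕ} (T : Triple n)
    (hτ : ∀ i : T.Pi₁, ((T.τ i : Fin (n - 1)) : ℕ) + 1 = ((i : Fin (n - 1)) : ℕ))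
    (y t x z : Fin n) :
    T.wedgeEntry y t x z = ind (Linked (fun s => ∃ i ∈ T.Pi₁, (i : ℕ) = s + 1) t z y x) := by
  rw [T.wedgeEntry_of_shift (show (-1 : ℤ) ≠ 0 by norm_num) fun i => by
    rw [← hτ i]; push_cast; ring]
  refine ind_congr ⟨?_, ?_⟩
  · rintro ⟨hyt, k, hk, h₁, h₂, h⟩
    rw [Finset.mem_Icc] at hk
    refine ⟨by omega, by omega, by omega, fun s hs hs' => ?_⟩
    obtain ⟨i, hi, he⟩ := h (max (s + 1) y) (max (s + 1) y - (s + 1)) (by omega) (by omega)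
      (by omega)
    exact ⟨i, hi, by omega⟩
  · rintro ⟨h₁, h₂, h₃, h⟩
    refine ⟨by omega, y - z, Finset.mem_Icc.2 (by omega), by omega, by omega,
      fun m l hm hm' hl => ?_⟩
    obtain ⟨i, hi, he⟩ := h (m - l - 1) (by omega) (by omega)
    exact ⟨i, hi, by omega⟩

/-! ### Matching the two formulas for the entries -/

/-- Here z and t lie strictly between y and x, so a hinge fails to balance exactly when its break s
+ 1 does too. -/
lemma balanced_iff {S : ℕ → Prop} {x y z t : ℕ} (hyt : y < t) (hyz : y < z)
    (h : x + y = z + t) : Balanced S x y z t ↔ ∀ s, y ≤ s → s + 2 ≤ x → S s := by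
  constructor
  · intro hb s hs hs'
    by_contra hS
    have := hb.2 s hS
    omega
  · refine fun hJ => ⟨h, fun s hS => ?_⟩
    by_contra hne
    exact hS (hJ s (by omega) (by omega))

lemma gervais_eq (S : ℕ → Prop) (x y z t : ℕ) :
    gervais S x y z t = -ind (x = z ∧ y = t ∧ x < y) + ind (x = t ∧ y = z ∧ y < t)
      + (ind (Linked S x y z t) - ind (Linked S y x t z)) := by
  by_cases hsum : x + y = z + t
  swap
  · rw [gervais, if_neg fun h => hsum h.1, ind_false (by omega), ind_false (by omega),
      ind_false fun h => hsum h.2.2.1, ind_false fun h => hsum (by have := h.2.2.1; omega)]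
    ring
  -- The cases are: y strictly smallest, x strictly smallest (one wedge term each), and neither. In
  -- the last case, either {z, t} = {x, y}, which leaves the Cartan and standard parts, or z and t
  -- lie on opposite sides outside the range of x and y, and everything vanishes.
  by_cases h₁ : y < t ∧ y < z
  · have hL : Linked S x y z t ↔ Balanced S x y z t := by
      rw [balanced_iff h₁.1 h₁.2 hsum]
      exact ⟨fun h => h.2.2.2, fun h => ⟨h₁.1, h₁.2, hsum, h⟩⟩
    rw [ind_false (show ¬ Linked S y x t z from fun h => by have := h.1; omega), ind_congr hL,
      ind_false (show ¬ (x = z ∧ y = t ∧ x < y) by omega),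
      ind_false (show ¬ (x = t ∧ y = z ∧ y < t) by omega), gervais, ind_true h₁.1,
      ind_false (show ¬ x < t by omega), ind]
    split_ifs <;> ring
  by_cases h₂ : x < z ∧ x < t
  · have hL : Linked S y x t z ↔ Balanced S x y z t := by
      have hb := balanced_iff (S := S) (x := y) (y := x) (z := t) (t := z) h₂.1 h₂.2 (by omega)
      constructor
      · intro h
        have := hb.2 h.2.2.2
        exact ⟨hsum, fun s hs => by have := this.2 s hs; omega⟩
      · intro h
        exact ⟨h₂.1, h₂.2, by omega, hb.1 ⟨by omega, fun s hs => by have := h.2 s hs; omega⟩⟩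
    rw [ind_false (show ¬ Linked S x y z t from fun h => by have := h.1; omega), ind_congr hL,
      ind_false (show ¬ (x = z ∧ y = t ∧ x < y) by omega),
      ind_false (show ¬ (x = t ∧ y = z ∧ y < t) by omega), gervais, ind_true h₂.2,
      ind_false (show ¬ y < t by omega), ind]
    split_ifs <;> ring
  rw [ind_false (show ¬ Linked S x y z t from fun h => h₁ ⟨h.1, h.2.1⟩),
    ind_false (show ¬ Linked S y x t z from fun h => h₂ ⟨h.1, h.2.1⟩), gervais]
  split_ifs with hb
  · unfold ind
    split_ifs <;> first | (exfalso; omega) | norm_num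
  · rw [ind_false, ind_false]
    · ring
    · rintro ⟨rfl, rfl, -⟩; exact hb ⟨by omega, fun _ _ => by omega⟩
    · rintro ⟨rfl, rfl, -⟩; exact hb ⟨rfl, fun _ _ => rfl⟩

lemma Triple.rMatrix_of_succ {n : ℕ} (T : Triple n)
    (hτ : ∀ i : T.Pi₁, ((T.τ i : Fin (n - 1)) : ℕ) = ((i : Fin (n - 1)) : ℕ) + 1) :
    T.rMatrix (fun p q => -ind (p < q)) =
      gervaisMatrix n fun s => ∃ i ∈ T.Pi₁, (i : ℕ) = s := by
  ext ⟨x, y⟩ ⟨z, t⟩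
  rw [T.rMatrix_apply, T.wedgeEntry_of_succ hτ, T.wedgeEntry_of_succ hτ]
  simp only [gervaisMatrix, Matrix.of_apply]
  rw [gervais_eq]
  congr 2
  · simp only [ind, ← Fin.ext_iff, Fin.lt_def, ite_and]
    split_ifs <;> simp
  · simp only [ind, E, Matrix.single_apply, Fin.lt_def, Fin.ext_iff]
    split_ifs <;> first | rfl | (exfalso; omega)

lemma Triple.rMatrix_of_pred {n : ℕ} (T : Triple n)
    (hτ : ∀ i : T.Pi₁, ((T.τ i : Fin (n - 1)) : ℕ) + 1 = ((i : Fin (n - 1)) : ℕ)) :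
    T.rMatrix (fun p q => -ind (q < p)) =
      gervaisMatrix' n fun s => ∃ i ∈ T.Pi₁, (i : ℕ) = s + 1 := by
  ext ⟨x, y⟩ ⟨z, t⟩
  rw [T.rMatrix_apply, T.wedgeEntry_of_pred hτ, T.wedgeEntry_of_pred hτ]
  simp only [gervaisMatrix', Matrix.of_apply]
  rw [gervais_eq]
  congr 2
  · simp only [ind, Fin.ext_iff, Fin.lt_def]
    split_ifs <;> first | (exfalso; omega) | simp
  · simp only [ind, E, Matrix.single_apply, Fin.lt_def, Fin.ext_iff]
    split_ifs <;> first | rfl | (exfalso; omega)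

end BelavinDrinfeld

open BelavinDrinfeld in
theorem mainTheorem10 (n : ℕ) (hn : 2 ≤ n) (T : BelavinDrinfeld.Triple n) :
    ((∃ r : Matrix (Fin n × Fin n) (Fin n × Fin n) ℂ,
        T.IsRMatrix r ∧ BelavinDrinfeld.P n * r = -r) ↔
      ∀ i : T.Pi₁, ((T.τ i : Fin (n - 1)) : ℕ) = ((i : Fin (n - 1)) : ℕ) + 1) ∧
    ((∃ r : Matrix (Fin n × Fin n) (Fin n × Fin n) ℂ,
        T.IsRMatrix r ∧ r * BelavinDrinfeld.P n = -r) ↔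
      ∀ i : T.Pi₁, ((T.τ i : Fin (n - 1)) : ℕ) + 1 = ((i : Fin (n - 1)) : ℕ)) := by
  refine ⟨⟨?_, fun hτ => ?_⟩, ⟨?_, fun hτ => ?_⟩⟩
  · rintro ⟨r, ⟨-, -, -, a, ha, rfl⟩, h⟩
    obtain rfl : a = fun p q => -ind (p < q) := by
      ext p q; exact T.rMatrix_eq_of_P_mul h p q
    exact T.compatible_lt_iff.1 ha
  · refine ⟨_, ⟨isClassicalYangBaxter_gervaisMatrix n _, ⟨1, -1, gervaisMatrix_add_flip n _⟩, ?_,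
      ⟨_, T.compatible_lt_iff.2 hτ, (T.rMatrix_of_succ hτ).symm⟩⟩, P_mul_gervaisMatrix n _⟩
    rw [gervaisMatrix_add_flip]
    exact P_sub_one_ne_zero hn
  · rintro ⟨r, ⟨-, -, -, a, ha, rfl⟩, h⟩
    obtain rfl : a = fun p q => -ind (q < p) := by
      ext p q; exact T.rMatrix_eq_of_mul_P h p q
    exact T.compatible_gt_iff.1 ha
  · refine ⟨_, ⟨isClassicalYangBaxter_gervaisMatrix' n _, ⟨1, -1, gervaisMatrix'_add_flip n _⟩, ?_,
      ⟨_, T.compatible_gt_iff.2 hτ, (T.rMatrix_of_pred hτ).symm⟩⟩, gervaisMatrix'_mul_P n _⟩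
    rw [gervaisMatrix'_add_flip]
    exact P_sub_one_ne_zero hn
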